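/- Let $(W,S)$ be a finite Coxeter system of rank $n=|S|$, let $T=\{wsw^{-1} : w\in W,\ s\in S\}$ be its set of reflections, and let $\ell(w)$ denote the minimal number of factors in an expression of $w\in W$ as a product of elements of $T$. The absolute order on $W$ is defined by $v\le w$ if and only if $\ell(w)=\ell(v)+\ell(v^{-1}w)$. Let $c\in W$ be any Coxeter element, that is, a conjugate of a product of all elements of $S$, each taken once, in some order, and let $\mathrm{NC}(W)=\mathrm{NC}(W,c)=\{w\in W : w\le c\}$ be the poset of non-crossing partitions, ordered by the absolute order. The Hurwitz graph $H(W)$ is the graph whose vertices are the maximal chains of $\mathrm{NC}(W)$, two of them being joined by an edge if and only if they differ in exactly one element. The radius of a graph is the minimum over its vertices $v$ of the eccentricity $\max_w \mathrm{d}(v,w)$. Then the radius of the Hurwitz graph satisfies $\operatorname{rad}(H(W))\ge\binom{n}{2}$. -/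

import Mathlib

namespace CoxeterSystem

variable {B W : Type*} [Group W] {M : CoxeterMatrix B} (cs : CoxeterSystem M W)

/-- The absolute length (reflection length) of `w`: the word length of `w` with respect to the
set of all reflections, i.e. all conjugates of simple reflections. -/
noncomputable def absLength (w : W) : ℕ :=
  sInf {k | ∃ l : List W, (∀ t ∈ l, cs.IsReflection t) ∧ l.prod = w ∧ l.length = k}

theorem exists_absLength (w : W) :
    ∃ l : List W, (∀ t ∈ l, cs.IsReflection t) ∧ l.prod = w ∧ l.length = cs.absLength w := by
  refine Nat.sInf_mem (s := {k | ∃ l : List W,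
    (∀ t ∈ l, cs.IsReflection t) ∧ l.prod = w ∧ l.length = k}) ?_
  obtain ⟨ω, hω⟩ := cs.wordProd_surjective w
  refine ⟨_, ω.map cs.simple, ?_, hω, rfl⟩
  intro t ht
  obtain ⟨i, -, rfl⟩ := List.mem_map.1 ht
  exact cs.isReflection_simple i

theorem absLength_prod_le (l : List W) (hl : ∀ t ∈ l, cs.IsReflection t) :
    cs.absLength l.prod ≤ l.length :=
  Nat.sInf_le ⟨l, hl, rfl, rfl⟩

theorem absLength_one : cs.absLength 1 = 0 :=
  Nat.le_zero.1 (cs.absLength_prod_le [] (by simp))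

theorem eq_one_of_absLength_eq_zero {w : W} (h : cs.absLength w = 0) : w = 1 := by
  obtain ⟨l, -, rfl, hl⟩ := cs.exists_absLength w
  rw [h] at hl
  simp [List.length_eq_zero_iff.1 hl]

theorem absLength_mul_le (v w : W) : cs.absLength (v * w) ≤ cs.absLength v + cs.absLength w := by
  obtain ⟨l, hl, hv, hlv⟩ := cs.exists_absLength v
  obtain ⟨k, hk, hw, hkw⟩ := cs.exists_absLength w
  have h := cs.absLength_prod_le (l ++ k) (by
    intro t ht
    rcases List.mem_append.1 ht with h | h
    exacts [hl t h, hk t h])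
  rwa [List.prod_append, List.length_append, hv, hw, hlv, hkw] at h

/-- The absolute order on `W`: `v ≤ w` iff `ℓ(w) = ℓ(v) + ℓ(v⁻¹ w)`, where `ℓ` is the absolute
length. -/
def AbsLE (v w : W) : Prop :=
  cs.absLength w = cs.absLength v + cs.absLength (v⁻¹ * w)

theorem AbsLE.rfl (w : W) : cs.AbsLE w w := by
  simp [AbsLE, absLength_one]

theorem AbsLE.trans {u v w : W} (h : cs.AbsLE u v) (h' : cs.AbsLE v w) : cs.AbsLE u w := by
  have h1 := cs.absLength_mul_le (u⁻¹ * v) (v⁻¹ * w)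
  have h2 := cs.absLength_mul_le u (u⁻¹ * w)
  have e1 : u⁻¹ * v * (v⁻¹ * w) = u⁻¹ * w := by group
  have e2 : u * (u⁻¹ * w) = w := by group
  rw [e1] at h1
  rw [e2] at h2
  unfold AbsLE at *
  omega

theorem AbsLE.antisymm {v w : W} (h : cs.AbsLE v w) (h' : cs.AbsLE w v) : v = w := by
  unfold AbsLE at *
  have h0 : cs.absLength (v⁻¹ * w) = 0 := by omega
  exact inv_mul_eq_one.1 (cs.eq_one_of_absLength_eq_zero h0)

/-- A standard Coxeter element: the product of the simple reflections, each taken exactly once,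
in some order. -/
def IsStandardCoxeterElement (c : W) : Prop :=
  ∃ l : List B, l.Nodup ∧ (∀ i : B, i ∈ l) ∧ c = cs.wordProd l

/-- A Coxeter element: a conjugate of a standard Coxeter element. -/
def IsCoxeterElement (c : W) : Prop :=
  ∃ c₀ : W, cs.IsStandardCoxeterElement c₀ ∧ IsConj c₀ c

/-- The non-crossing partitions `NC(W, c)`: the elements below `c` in the absolute order. -/
def NC (c : W) := {w : W // cs.AbsLE w c}

/-- `NC(W, c)` carries the absolute order. -/
instance (c : W) : PartialOrder (cs.NC c) where
  le v w := cs.AbsLE v.1 w.1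
  le_refl v := AbsLE.rfl cs v.1
  le_trans _ _ _ h h' := AbsLE.trans cs h h'
  le_antisymm _ _ h h' := Subtype.ext (AbsLE.antisymm cs h h')

/-- The Hurwitz graph: its vertices are the maximal chains of `NC(W, c)`, and two of them are
adjacent iff they differ in exactly one element, i.e. each contains exactly one element that is
missing from the other. -/
def hurwitzGraph (c : W) : SimpleGraph (Flag (cs.NC c)) where
  Adj C D := ((C : Set (cs.NC c)) \ D).ncard = 1 ∧ ((D : Set (cs.NC c)) \ C).ncard = 1
  symm := ⟨fun _ _ h => ⟨h.2, h.1⟩⟩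
  loopless := ⟨fun _ h => by simp at h⟩

end CoxeterSystem

/-! Every maximal chain `C` has a partner at distance at least `n.choose 2`: its image under the
Kreweras complement `v ↦ v⁻¹ c`. Chains become complete flags in the geometric representation on
`ℝⁿ` by sending `v` to its moved space, the range of `v - 1`. This works because finiteness of `W`
makes `c - 1` invertible, so `ℓ(c) = n`, and then length equals the dimension of the moved space
below `c` (`AbsLE.moved`).

The relative position of two complete flags is a permutation. An edge of the Hurwitz graph alters
one step of the flag, so the relative position to `C` changes at most by swapping two adjacent
values and gains at most one inversion (`relInversions_le_of_adj`). It has no inversions at `C`. At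
the partner the moved spaces of `v` and `v⁻¹ c` are complementary, so the flags are opposite and all
pairs are inverted (`relInversions_oppositeFlag`). -/

/-! ### Inversions -/

/-- The pairs `i < j < n`, stored as `⟨j, i⟩`, whose order is reversed by `p`. -/
def inversionPairs (n : ℕ) (p : ℕ → ℕ) : Finset (Σ _ : ℕ, ℕ) :=
  ((Finset.range n).sigma fun j => Finset.range j).filter fun x => p x.1 < p x.2

theorem mem_inversionPairs {n : ℕ} {p : ℕ → ℕ} {x : Σ _ : ℕ, ℕ} :
    x ∈ inversionPairs n p ↔ (x.1 < n ∧ x.2 < x.1) ∧ p x.1 < p x.2 := by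
  simp [inversionPairs]

theorem inversionPairs_eq_empty {n : ℕ} {p : ℕ → ℕ} (hp : ∀ j < n, ∀ i < j, p i ≤ p j) :
    inversionPairs n p = ∅ := by
  refine Finset.eq_empty_of_forall_notMem fun x hx => ?_
  rw [mem_inversionPairs] at hx
  exact absurd hx.2 (not_lt.2 (hp _ hx.1.1 _ hx.1.2))

theorem card_inversionPairs_of_anti {n : ℕ} {p : ℕ → ℕ} (hp : ∀ j < n, ∀ i < j, p j < p i) :
    (inversionPairs n p).card = n.choose 2 := by
  rw [inversionPairs, Finset.filter_true_of_mem, Finset.card_sigma]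
  · simp [Finset.sum_range_id, Nat.choose_two_right]
  · intro x hx
    simp only [Finset.mem_sigma, Finset.mem_range] at hx
    exact hp _ hx.1 _ hx.2

/-- If `q` arises from `p` by permuting the places of the two adjacent values `j` and `j + 1`,
then it has at most one inversion more. -/
theorem card_inversionPairs_le_add_one {n j : ℕ} {p q : ℕ → ℕ}
    (hp : ∀ a < n, ∀ b < n, p a = p b → a = b)
    (hne : ∀ a < n, p a ≠ j → p a ≠ j + 1 → q a = p a)
    (heq : ∀ a < n, p a = j ∨ p a = j + 1 → q a = j ∨ q a = j + 1) :
    (inversionPairs n q).card ≤ (inversionPairs n p).card + 1 := by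
  -- A new inversion must sit at the two places where `p` takes the values `j` and `j + 1`;
  -- injectivity of `p` leaves only one such pair.
  have key : (inversionPairs n q \ inversionPairs n p).card ≤ 1 := by
    refine Finset.card_le_one.2 ?_
    have h : ∀ x ∈ inversionPairs n q \ inversionPairs n p, (x.1 < n ∧ x.2 < x.1) ∧
        (p x.1 = j ∨ p x.1 = j + 1) ∧ (p x.2 = j ∨ p x.2 = j + 1) ∧ p x.1 ≠ p x.2 := by
      intro x hx
      rw [Finset.mem_sdiff, mem_inversionPairs, mem_inversionPairs] at hx
      obtain ⟨⟨hx, hq⟩, hx'⟩ := hx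
      have h2 : x.2 < n := hx.2.trans hx.1
      have hpx : p x.1 ≠ p x.2 := fun h => hx.2.ne' (hp _ hx.1 _ h2 h)
      have hlt : ¬ p x.1 < p x.2 := fun h => hx' ⟨hx, h⟩
      have a1 := hne x.1 hx.1
      have a2 := hne x.2 h2
      have b1 := heq x.1 hx.1
      have b2 := heq x.2 h2
      refine ⟨hx, ?_⟩
      omega
    rintro ⟨a, b⟩ hx ⟨a', b'⟩ hy
    have hx := h _ hx
    have hy := h _ hy
    dsimp only at hx hy
    have haa := hp a (by omega) a' (by omega)
    have hbb := hp b (by omega) b' (by omega)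
    have hab := hp a (by omega) b' (by omega)
    have hba := hp b (by omega) a' (by omega)
    obtain rfl : a = a' := by omega
    obtain rfl : b = b' := by omega
    rfl
  have := Finset.card_le_card_sdiff_add_card (s := inversionPairs n q) (t := inversionPairs n p)
  omega

/-! ### Relative position of two flags of subspaces -/

section RelativePosition

variable {K V : Type*} [Field K] [AddCommGroup V] [Module K V]

/-- The position of a sequence of subspaces `E` relative to the `i`-th step of the sequence `C`:
the first index `k` such that `E k` meets `C (i + 1)` outside of `C i`. -/
noncomputable def relPos (C E : ℕ → Submodule K V) (i : ℕ) : ℕ :=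
  sInf {k | ¬ E k ⊓ C (i + 1) ≤ C i}

variable {C E E' : ℕ → Submodule K V} {i k n : ℕ}

theorem relPos_le (h : ¬ E k ⊓ C (i + 1) ≤ C i) : relPos C E i ≤ k :=
  Nat.sInf_le h

theorem inf_le_of_lt_relPos (h : k < relPos C E i) : E k ⊓ C (i + 1) ≤ C i :=
  not_not.1 (Nat.notMem_of_lt_sInf h)

theorem not_inf_le_relPos (hE : E n = ⊤) (hC : C i < C (i + 1)) :
    ¬ E (relPos C E i) ⊓ C (i + 1) ≤ C i :=
  Nat.sInf_mem (s := {k | ¬ E k ⊓ C (i + 1) ≤ C i}) ⟨n, by simpa [hE] using hC.not_ge⟩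

theorem relPos_eq (hE : Monotone E) (hk : ¬ E (k + 1) ⊓ C (i + 1) ≤ C i)
    (hk' : E k ⊓ C (i + 1) ≤ C i) : relPos C E i = k + 1 := by
  refine le_antisymm (relPos_le hk) ?_
  by_contra! h
  exact Nat.sInf_mem (s := {k | ¬ E k ⊓ C (i + 1) ≤ C i}) ⟨_, hk⟩
    ((inf_le_inf_right _ (hE (Nat.lt_succ_iff.1 h))).trans hk')

/-- Suppose both values are `k + 1`. A witness `x` for `i` spans `E (k + 1)` modulo `E k` and lies
in `C i'`. Subtracting a multiple of it from a witness `y` for `i'` lands in `E k ⊓ C (i' + 1) ≤ C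
i'`, so `y ∈ C i'`, a contradiction. -/
theorem relPos_ne_of_lt {i' : ℕ} (hE0 : E 0 = ⊥) (hEn : E n = ⊤) (hC : Monotone C)
    (hcov : ∀ k, ∀ x ∈ E (k + 1), x ∉ E k → E (k + 1) ≤ E k ⊔ Submodule.span K {x})
    (hi : C i < C (i + 1)) (hi' : C i' < C (i' + 1)) (h : i < i') :
    relPos C E i ≠ relPos C E i' := by
  intro heq
  have h1 := not_inf_le_relPos hEn hi
  have h2 := not_inf_le_relPos hEn hi'
  rw [← heq] at h2
  rcases hk : relPos C E i with _ | k
  · rw [hk, hE0] at h1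
    simp at h1
  rw [hk] at h1 h2
  have h3 : E k ⊓ C (i + 1) ≤ C i := inf_le_of_lt_relPos (by omega)
  have h4 : E k ⊓ C (i' + 1) ≤ C i' := inf_le_of_lt_relPos (by omega)
  obtain ⟨x, ⟨hxE, hxC⟩, hx⟩ := SetLike.not_le_iff_exists.1 h1
  obtain ⟨y, ⟨hyE, hyC⟩, hy⟩ := SetLike.not_le_iff_exists.1 h2
  obtain ⟨e, he, z, hz, rfl⟩ :=
    Submodule.mem_sup.1 (hcov k x hxE (fun hxk => hx (h3 ⟨hxk, hxC⟩)) hyE)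
  have hz' : z ∈ C i' := by
    refine (Submodule.span_singleton_le_iff_mem _ _).2 ?_ hz
    exact hC (by omega) hxC
  refine hy (add_mem (h4 ⟨he, ?_⟩) hz')
  simpa using sub_mem hyC (hC (Nat.le_succ i') hz')

theorem relPos_injOn {a b : ℕ} (hE0 : E 0 = ⊥) (hEn : E n = ⊤) (hC : Monotone C)
    (hcov : ∀ k, ∀ x ∈ E (k + 1), x ∉ E k → E (k + 1) ≤ E k ⊔ Submodule.span K {x})
    (ha : C a < C (a + 1)) (hb : C b < C (b + 1))
    (h : relPos C E a = relPos C E b) : a = b := by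
  by_contra hab
  rcases Nat.lt_or_gt_of_ne hab with hab | hab
  · exact relPos_ne_of_lt hE0 hEn hC hcov ha hb hab h
  · exact relPos_ne_of_lt hE0 hEn hC hcov hb ha hab h.symm

/-- A value `k + 1` is determined by `E k` and `E (k + 1)` alone, so only the values `j` and `j + 1`
can notice a change of `E j`. -/
theorem relPos_congr {j : ℕ} (hE : Monotone E) (hE' : Monotone E') (hEn : E n = ⊤)
    (hj : ∀ k, k ≠ j → E k = E' k) (hi : C i < C (i + 1)) :
    (relPos C E i ≠ j → relPos C E i ≠ j + 1 → relPos C E' i = relPos C E i) ∧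
    (relPos C E i = j ∨ relPos C E i = j + 1 → relPos C E' i = j ∨ relPos C E' i = j + 1) := by
  have h1 := not_inf_le_relPos hEn hi
  have hlt : ∀ k < relPos C E i, k ≠ j → E' k ⊓ C (i + 1) ≤ C i := fun k hk hkj =>
    hj k hkj ▸ inf_le_of_lt_relPos hk
  constructor
  · intro ha hb
    obtain hk | hk := Nat.eq_zero_or_eq_succ_pred (relPos C E i)
    · rw [hk] at h1 ha ⊢
      rw [hj _ ha] at h1
      exact Nat.le_zero.1 (relPos_le h1)
    · rw [hk] at h1 ha hb ⊢
      rw [hj _ ha] at h1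
      exact relPos_eq hE' h1 (hlt _ (by omega) (by omega))
  · intro h
    have h2 : ¬ E' (j + 1) ⊓ C (i + 1) ≤ C i := by
      rw [← hj (j + 1) (by omega)]
      exact fun h' => h1 ((inf_le_inf_right _ (hE (by omega))).trans h')
    have h3 := relPos_le h2
    by_contra h4
    have h5 : relPos C E' i < j := by omega
    have h6 : ¬ E' (relPos C E' i) ⊓ C (i + 1) ≤ C i :=
      Nat.sInf_mem (s := {k | ¬ E' k ⊓ C (i + 1) ≤ C i}) ⟨_, h2⟩
    exact h6 (hlt _ (by omega) (by omega))

end RelativePosition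

/-! ### Absolute order, Kreweras complement and maximal chains -/

namespace CoxeterSystem

variable {B W : Type*} [Group W] {M : CoxeterMatrix B} (cs : CoxeterSystem M W)

theorem absLength_conj_le (g w : W) : cs.absLength (g * w * g⁻¹) ≤ cs.absLength w := by
  obtain ⟨l, hl, rfl, hlen⟩ := cs.exists_absLength w
  have := cs.absLength_prod_le (l.map (MulAut.conj g)) (by
    intro t ht
    obtain ⟨r, hr, rfl⟩ := List.mem_map.1 ht
    exact (hl r hr).conj g)
  rwa [← map_list_prod, List.length_map, hlen] at this

theorem absLength_conj (g w : W) : cs.absLength (g * w * g⁻¹) = cs.absLength w := by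
  refine le_antisymm (cs.absLength_conj_le g w) ?_
  simpa [mul_assoc] using cs.absLength_conj_le g⁻¹ (g * w * g⁻¹)

theorem absLength_mul_comm (v w : W) : cs.absLength (v * w) = cs.absLength (w * v) := by
  rw [← cs.absLength_conj w (v * w)]
  congr 1
  group

theorem AbsLE.eq_of_absLength_le {cs : CoxeterSystem M W} {v w : W} (h : cs.AbsLE v w)
    (h' : cs.absLength w ≤ cs.absLength v) : v = w := by
  unfold AbsLE at h
  exact inv_mul_eq_one.1 (cs.eq_one_of_absLength_eq_zero (by omega))

theorem one_absLE (w : W) : cs.AbsLE 1 w := by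
  simp [AbsLE, absLength_one]

/-- Cut a shortest reflection word of `v⁻¹ w` after `k - ℓ(v)` letters; subadditivity of the length
forces all the inequalities to be equalities. -/
theorem AbsLE.exists_between {cs : CoxeterSystem M W} {v w : W} (h : cs.AbsLE v w) {k : ℕ}
    (hv : cs.absLength v ≤ k) (hw : k ≤ cs.absLength w) :
    ∃ y, cs.AbsLE v y ∧ cs.AbsLE y w ∧ cs.absLength y = k := by
  obtain ⟨l, hl, hlp, hlen⟩ := cs.exists_absLength (v⁻¹ * w)
  set m := k - cs.absLength v
  have h1 := cs.absLength_prod_le (l.take m) fun t ht => hl t (List.mem_of_mem_take ht)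
  have h2 := cs.absLength_prod_le (l.drop m) fun t ht => hl t (List.mem_of_mem_drop ht)
  have h3 : (l.take m).prod * (l.drop m).prod = v⁻¹ * w := by rw [List.prod_take_mul_prod_drop, hlp]
  have h4 : (v * (l.take m).prod)⁻¹ * w = (l.drop m).prod := by
    rw [mul_inv_rev, mul_assoc, ← h3]
    group
  have h5 := cs.absLength_mul_le v (l.take m).prod
  have h6 := cs.absLength_mul_le (v * (l.take m).prod) ((v * (l.take m).prod)⁻¹ * w)
  rw [mul_inv_cancel_left] at h6
  rw [List.length_take] at h1
  rw [List.length_drop] at h2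
  refine ⟨v * (l.take m).prod, ?_, ?_, ?_⟩ <;> unfold AbsLE at * <;>
    simp only [h4, inv_mul_cancel_left] at * <;> omega

/-- The quotient of the two complements is conjugate to `w v⁻¹`, which has the same length as `v⁻¹
w`. -/
theorem AbsLE.kreweras {cs : CoxeterSystem M W} {v w c : W} (hvw : cs.AbsLE v w)
    (hwc : cs.AbsLE w c) : cs.AbsLE (w⁻¹ * c) (v⁻¹ * c) := by
  have hvc := hvw.trans cs hwc
  have h : cs.absLength ((w⁻¹ * c)⁻¹ * (v⁻¹ * c)) = cs.absLength (v⁻¹ * w) := by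
    rw [← cs.absLength_conj c, cs.absLength_mul_comm v⁻¹ w]
    congr 1
    group
  unfold AbsLE at *
  omega

theorem AbsLE.kreweras_symm {cs : CoxeterSystem M W} {v w c : W} (hvw : cs.AbsLE v w)
    (hwc : cs.AbsLE w c) : cs.AbsLE (c * w⁻¹) (c * v⁻¹) := by
  have h := hvw.kreweras hwc
  unfold AbsLE at *
  rw [cs.absLength_mul_comm c, cs.absLength_mul_comm c, h]
  congr 1
  rw [← cs.absLength_conj c ((w⁻¹ * c)⁻¹ * (v⁻¹ * c))]
  congr 1
  group

/-- The Kreweras complement `v ↦ v⁻¹ c`, an anti-automorphism of `NC(W, c)`. -/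
def kreweras (c : W) : cs.NC c ≃o (cs.NC c)ᵒᵈ where
  toFun v := OrderDual.toDual ⟨v.1⁻¹ * c, by
    simpa using (cs.one_absLE v.1).kreweras v.2⟩
  invFun v := ⟨c * (OrderDual.ofDual v).1⁻¹, by
    simpa using (cs.one_absLE (OrderDual.ofDual v).1).kreweras_symm (OrderDual.ofDual v).2⟩
  left_inv v := Subtype.ext (show c * (v.1⁻¹ * c)⁻¹ = v.1 by simp)
  right_inv v := Subtype.ext
    (show (c * (OrderDual.ofDual v).1⁻¹)⁻¹ * c = (OrderDual.ofDual v).1 by simp)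
  map_rel_iff' := by
    intro v w
    constructor
    · intro h
      have := AbsLE.kreweras_symm (cs := cs) (v := w.1⁻¹ * c) (w := v.1⁻¹ * c) (c := c) h
        (by simpa using (cs.one_absLE v.1).kreweras v.2)
      simp only [mul_inv_rev, inv_inv, mul_inv_cancel_left] at this
      exact this
    · intro h
      exact AbsLE.kreweras (cs := cs) (v := v.1) (w := w.1) h w.2

variable {cs} {c : W}

theorem flag_eq_of_absLength_eq (F : Flag (cs.NC c)) {x y : cs.NC c} (hx : x ∈ F) (hy : y ∈ F)
    (h : cs.absLength x.1 = cs.absLength y.1) : x = y := by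
  rcases F.le_or_le hx hy with h' | h'
  · exact Subtype.ext (AbsLE.eq_of_absLength_le h' h.ge)
  · exact (Subtype.ext (AbsLE.eq_of_absLength_le h' h.le)).symm

theorem flag_le_of_absLength_le (F : Flag (cs.NC c)) {x y : cs.NC c} (hx : x ∈ F) (hy : y ∈ F)
    (h : cs.absLength x.1 ≤ cs.absLength y.1) : x ≤ y := by
  rcases F.le_or_le hx hy with h' | h'
  · exact h'
  · have heq : y = x := Subtype.ext (AbsLE.eq_of_absLength_le h' h)
    exact heq.ge

theorem flag_mem_of_comparable (F : Flag (cs.NC c)) {y : cs.NC c}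
    (h : ∀ x ∈ F, x ≤ y ∨ y ≤ x) : y ∈ F := by
  have hi : IsChain (· ≤ ·) (insert y (F : Set (cs.NC c))) :=
    F.chain_le.insert fun x hx _ => (h x hx).symm
  have := F.maxChain.2 hi (Set.subset_insert _ _)
  change y ∈ (F : Set (cs.NC c))
  rw [this]
  exact Set.mem_insert _ _

/-- If length `k` were skipped, an element of length `k` between the neighbours `v`, `w` of the gap
would be comparable to the whole chain, contradicting maximality. -/
theorem exists_mem_flag (F : Flag (cs.NC c)) {k : ℕ} (hk : k ≤ cs.absLength c) :
    ∃ x ∈ F, cs.absLength x.1 = k := by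
  by_contra! hne
  have h1 : (⟨1, cs.one_absLE c⟩ : cs.NC c) ∈ F :=
    flag_mem_of_comparable F fun x _ => Or.inr (cs.one_absLE x.1)
  have hc : (⟨c, AbsLE.rfl cs c⟩ : cs.NC c) ∈ F :=
    flag_mem_of_comparable F fun x _ => Or.inl x.2
  have hk0 : 0 < k := by
    have := hne _ h1
    rw [absLength_one] at this
    omega
  have hkc : k < cs.absLength c := lt_of_le_of_ne hk (hne _ hc).symm
  -- Here `m` measures the distance from length `k`, so `Nat.find` picks the nearest elements below
  -- and above.
  have hex : ∃ m, ∃ x ∈ F, cs.absLength x.1 + m + 1 = k :=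
    ⟨k - 1, _, h1, by rw [absLength_one]; omega⟩
  have hex' : ∃ m, ∃ x ∈ F, cs.absLength x.1 = k + m + 1 :=
    ⟨cs.absLength c - k - 1, _, hc, by dsimp only; omega⟩
  classical
  obtain ⟨v, hvF, hv⟩ := Nat.find_spec hex
  obtain ⟨w, hwF, hw⟩ := Nat.find_spec hex'
  have hle : ∀ x ∈ F, cs.absLength x.1 < k → cs.absLength x.1 ≤ cs.absLength v.1 := by
    intro x hx hxk
    have := Nat.find_min' hex ⟨x, hx, (by omega :
      cs.absLength x.1 + (k - cs.absLength x.1 - 1) + 1 = k)⟩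
    omega
  have hge : ∀ x ∈ F, k < cs.absLength x.1 → cs.absLength w.1 ≤ cs.absLength x.1 := by
    intro x hx hxk
    have := Nat.find_min' hex' ⟨x, hx, (by omega :
      cs.absLength x.1 = k + (cs.absLength x.1 - k - 1) + 1)⟩
    omega
  obtain ⟨y, hvy, hyw, hy⟩ := AbsLE.exists_between (k := k)
    (flag_le_of_absLength_le F hvF hwF (by omega)) (by omega) (by omega)
  refine hne ⟨y, hyw.trans cs w.2⟩ (flag_mem_of_comparable F fun x hx => ?_) hy
  rcases Nat.lt_or_gt_of_ne (hne x hx) with h | h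
  · exact Or.inl (AbsLE.trans cs (flag_le_of_absLength_le F hx hvF (hle x hx h)) hvy)
  · exact Or.inr (AbsLE.trans cs hyw (flag_le_of_absLength_le F hwF hx (hge x hx h)))

/-- The element of absolute length `k` (or `ℓ(c)`, if this is smaller) of a maximal chain. -/
noncomputable def flagElt (F : Flag (cs.NC c)) (k : ℕ) : cs.NC c :=
  (exists_mem_flag F (min_le_right k (cs.absLength c))).choose

theorem flagElt_mem (F : Flag (cs.NC c)) (k : ℕ) : flagElt F k ∈ F :=
  (exists_mem_flag F (min_le_right k (cs.absLength c))).choose_spec.1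

theorem absLength_flagElt (F : Flag (cs.NC c)) (k : ℕ) :
    cs.absLength (flagElt F k).1 = min k (cs.absLength c) :=
  (exists_mem_flag F (min_le_right k (cs.absLength c))).choose_spec.2

theorem flagElt_eq (F : Flag (cs.NC c)) {k : ℕ} {x : cs.NC c} (hx : x ∈ F)
    (h : cs.absLength x.1 = min k (cs.absLength c)) : flagElt F k = x :=
  flag_eq_of_absLength_eq F (flagElt_mem F k) hx ((absLength_flagElt F k).trans h.symm)

theorem flagElt_mono (F : Flag (cs.NC c)) : Monotone (flagElt F) := by
  intro k m hkm
  refine flag_le_of_absLength_le F (flagElt_mem F k) (flagElt_mem F m) ?_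
  rw [absLength_flagElt, absLength_flagElt]
  omega

theorem flagElt_zero (F : Flag (cs.NC c)) : (flagElt F 0).1 = 1 :=
  cs.eq_one_of_absLength_eq_zero (by rw [absLength_flagElt]; simp)

theorem flagElt_of_le (F : Flag (cs.NC c)) {k : ℕ} (hk : cs.absLength c ≤ k) :
    (flagElt F k).1 = c :=
  AbsLE.eq_of_absLength_le (flagElt F k).2 (by rw [absLength_flagElt]; omega)

theorem exists_flagElt_eq_of_adj {F F' : Flag (cs.NC c)} (h : (cs.hurwitzGraph c).Adj F F') :
    ∃ j, ∀ k, k ≠ j → flagElt F k = flagElt F' k := by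
  obtain ⟨x, hx⟩ := Set.ncard_eq_one.1 h.1
  -- `flagElt` is constant from `ℓ(c)` on, so a single index `j` suffices only if `x` is not the
  -- top; the top lies in every maximal chain.
  by_cases hxc : cs.absLength x.1 = cs.absLength c
  · exfalso
    have hx' : x ∈ (F : Set (cs.NC c)) \ F' := hx ▸ Set.mem_singleton x
    have := AbsLE.eq_of_absLength_le x.2 hxc.ge
    refine hx'.2 (flag_mem_of_comparable F' fun y _ => Or.inl ?_)
    change cs.AbsLE y.1 x.1
    rw [this]
    exact y.2
  refine ⟨cs.absLength x.1, fun k hk => ?_⟩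
  by_cases hkF : flagElt F k ∈ F'
  · exact (flagElt_eq F' hkF (absLength_flagElt F k)).symm
  · have hm : flagElt F k ∈ (F : Set (cs.NC c)) \ F' := ⟨flagElt_mem F k, hkF⟩
    rw [hx, Set.mem_singleton_iff] at hm
    have := absLength_flagElt F k
    rw [hm] at this
    omega

/-- The image of a maximal chain under the Kreweras complement. -/
noncomputable def oppositeFlag (F : Flag (cs.NC c)) : Flag (cs.NC c) :=
  Flag.ofIsMaxChain (OrderDual.ofDual '' (Flag.map (cs.kreweras c) F : Set (cs.NC c)ᵒᵈ)) <| by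
    have h := (Flag.map (cs.kreweras c) F).maxChain.symm
    exact h.image (OrderIso.refl _)

theorem flagElt_oppositeFlag (F : Flag (cs.NC c)) {k : ℕ} (hk : k ≤ cs.absLength c) :
    (flagElt (oppositeFlag F) (cs.absLength c - k)).1 = (flagElt F k).1⁻¹ * c := by
  have hmem : OrderDual.ofDual (cs.kreweras c (flagElt F k)) ∈ oppositeFlag F :=
    ⟨_, ⟨_, flagElt_mem F k, rfl⟩, rfl⟩
  rw [flagElt_eq _ hmem]
  · rfl
  · have h1 := (flagElt F k).2
    have h2 := absLength_flagElt F k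
    change cs.absLength ((flagElt F k).1⁻¹ * c) = _
    unfold AbsLE at h1
    omega

end CoxeterSystem

/-! ### The dihedral relation for two reflections -/

open Module in
/-- The relation `(r₁ r₂) ^ m = 1` for two reflections at the angle `π / m`. -/
theorem Module.reflection_mul_reflection_pow_eq_one {V : Type*} [AddCommGroup V] [Module ℝ V]
    {x y : V} {f g : Dual ℝ V} (hf : f x = 2) (hg : g y = 2) {m : ℕ} (hm : 2 ≤ m)
    (hfy : f y = -2 * Real.cos (Real.pi / m)) (hgx : g x = -2 * Real.cos (Real.pi / m)) :
    (reflection hf * reflection hg) ^ m = 1 := by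
  ext z
  rw [reflection_mul_reflection_pow_apply hf hg m z]
  -- For `m = 2` the angle `θ = 2π / m` has `sin θ = 0`. Otherwise `S_n(2 cos θ) sin θ = sin ((n +
  -- 1) θ)` gives `S_{k-1} = 0` if `m = 2k`, and `S_k + S_{k-1} = 0` if `m = 2k + 1`.
  obtain rfl | hm3 := hm.eq_or_lt
  · have h0 : Real.cos (Real.pi / (2 : ℕ)) = 0 := by simp
    rw [h0] at hfy hgx
    simp only [hfy, hgx]
    norm_num
    abel
  set θ : ℝ := 2 * Real.pi / m with hθ
  have hm0 : (0 : ℝ) < m := by positivity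
  have hmθ : m * θ = 2 * Real.pi := by rw [hθ]; field_simp
  have hsin : Real.sin θ ≠ 0 := by
    refine (Real.sin_pos_of_pos_of_lt_pi (by positivity) ?_).ne'
    rw [hθ, div_lt_iff₀ hm0, mul_comm]
    have : (3 : ℝ) ≤ m := by exact_mod_cast hm3
    nlinarith [Real.pi_pos]
  have ht : f y * g x - 2 = 2 * Real.cos θ := by
    rw [hfy, hgx, hθ, show 2 * Real.pi / m = 2 * (Real.pi / m) by ring, Real.cos_two_mul]
    ring
  rw [ht]
  have hS := fun n => Polynomial.Chebyshev.S_two_mul_real_cos θ n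
  obtain ⟨k, hk | hk⟩ := m.even_or_odd'
  · have e1 : ((m : ℤ) - 2) / 2 = k - 1 := by omega
    have e2 : ((m : ℤ) - 1) / 2 = k - 1 := by omega
    have h0 : (Polynomial.Chebyshev.S ℝ ((k : ℤ) - 1)).eval (2 * Real.cos θ) = 0 := by
      refine (mul_eq_zero.1 ?_).resolve_right hsin
      rw [hS]
      have : ((((k : ℤ) - 1 : ℤ) : ℝ) + 1) * θ = Real.pi := by
        rw [hk] at hmθ
        push_cast at hmθ ⊢
        linarith
      rw [this, Real.sin_pi]
    rw [e1, e2, h0]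
    simp
  · have e1 : ((m : ℤ) - 2) / 2 = k - 1 := by omega
    have e2 : ((m : ℤ) - 1) / 2 = k := by omega
    have e3 : ((m : ℤ) - 3) / 2 = k - 1 := by omega
    have e4 : (m : ℤ) / 2 = k := by omega
    have h0 : (Polynomial.Chebyshev.S ℝ (k : ℤ)).eval (2 * Real.cos θ) +
        (Polynomial.Chebyshev.S ℝ ((k : ℤ) - 1)).eval (2 * Real.cos θ) = 0 := by
      refine (mul_eq_zero.1 ?_).resolve_right hsin
      rw [add_mul, hS, hS]
      have : ((((k : ℤ) - 1 : ℤ) : ℝ) + 1) * θ = 2 * Real.pi - (((k : ℤ) : ℝ) + 1) * θ := by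
        rw [hk] at hmθ
        push_cast at hmθ ⊢
        linarith
      rw [this, Real.sin_two_pi_sub]
      ring
    rw [e1, e2, e3, e4, h0]
    simp

/-! ### Moved spaces -/

namespace Representation

variable {K G V : Type*} [Field K] [Group G] [AddCommGroup V] [Module K V]
  (ρ : Representation K G V)

/-- The moved space of `g`: the range of `ρ g - 1`. -/
def moved (g : G) : Submodule K V := LinearMap.range (ρ g - 1)

theorem moved_one : ρ.moved 1 = ⊥ := by
  simp [moved]

theorem moved_mul_le (g h : G) : ρ.moved (g * h) ≤ ρ.moved g ⊔ ρ.moved h := by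
  rintro _ ⟨x, rfl⟩
  refine Submodule.mem_sup.2 ⟨_, ⟨ρ h x, rfl⟩, _, ⟨x, rfl⟩, ?_⟩
  simp

theorem moved_conj (g h : G) : ρ.moved (g * h * g⁻¹) = (ρ.moved h).map (ρ g) := by
  apply le_antisymm
  · rintro _ ⟨x, rfl⟩
    exact ⟨_, ⟨ρ g⁻¹ x, rfl⟩, by simp⟩
  · rintro _ ⟨_, ⟨x, rfl⟩, rfl⟩
    exact ⟨ρ g x, by simp⟩

theorem finrank_moved_mul_le [FiniteDimensional K V] (g h : G) :
    Module.finrank K (ρ.moved (g * h)) ≤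
      Module.finrank K (ρ.moved g) + Module.finrank K (ρ.moved h) :=
  (Submodule.finrank_mono (ρ.moved_mul_le g h)).trans
    (Submodule.finrank_add_le_finrank_add_finrank _ _)

end Representation

/-! ### The geometric representation and Coxeter elements -/

namespace CoxeterSystem

open Module

variable {B W : Type*} [Group W] {M : CoxeterMatrix B} (cs : CoxeterSystem M W)

theorem IsCoxeterElement.absLength_le [Fintype B] {cs : CoxeterSystem M W} {c : W}
    (hc : cs.IsCoxeterElement c) : cs.absLength c ≤ Fintype.card B := by
  obtain ⟨_, ⟨l, hl, hmem, rfl⟩, hconj⟩ := hc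
  obtain ⟨g, rfl⟩ := isConj_iff.1 hconj
  rw [absLength_conj]
  refine (cs.absLength_prod_le (l.map cs.simple) ?_).trans ?_
  · intro t ht
    obtain ⟨i, -, rfl⟩ := List.mem_map.1 ht
    exact cs.isReflection_simple i
  · rw [List.length_map]
    exact hl.length_le_card

section Geometric

variable [Fintype B] [DecidableEq B] (M)

/-- Twice the canonical bilinear form of a Coxeter matrix, with a simple root inserted on the
left. -/
noncomputable def simpleCoroot (i : B) : Dual ℝ (B → ℝ) :=
  -- An entry `M i j = 0`, meaning infinite order, gives `-2` because `π / 0 = 0`; a diagonal entry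
  -- gives `-2 cos π = 2`.
  ∑ j, (-2 * Real.cos (Real.pi / M i j)) • LinearMap.proj j

theorem simpleCoroot_single (i j : B) :
    simpleCoroot M i (Pi.single j 1) = -2 * Real.cos (Real.pi / M i j) := by
  simp [simpleCoroot, Pi.single_apply]

theorem simpleCoroot_single_self (i : B) : simpleCoroot M i (Pi.single i 1) = 2 := by
  simp [simpleCoroot_single]

theorem isLiftable_reflection :
    M.IsLiftable fun i =>
      ((reflection (simpleCoroot_single_self M i)) : (B → ℝ) →ₗ[ℝ] (B → ℝ)) := by
  intro i j
  have key : (reflection (simpleCoroot_single_self M i) *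
      reflection (simpleCoroot_single_self M j)) ^ M i j = 1 := by
    by_cases hij : i = j
    · subst hij
      refine LinearEquiv.ext fun z => ?_
      rw [M.diagonal, pow_one, LinearEquiv.mul_apply]
      exact involutive_reflection _ z
    obtain h0 | h1 | h2 : M i j = 0 ∨ M i j = 1 ∨ 2 ≤ M i j := by omega
    · rw [h0, pow_zero]
    · exact absurd h1 (M.off_diagonal i j hij)
    · refine reflection_mul_reflection_pow_eq_one _ _ h2 (simpleCoroot_single M i j) ?_
      rw [simpleCoroot_single, M.symmetric]
  have := congrArg (LinearEquiv.automorphismGroup.toLinearMapMonoidHom (R := ℝ) (M := B → ℝ)) key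
  rw [map_pow, map_mul, map_one] at this
  exact this

variable {M}

/-- The geometric representation of a Coxeter group. -/
noncomputable def geometricRep : Representation ℝ W (B → ℝ) :=
  cs.lift ⟨_, isLiftable_reflection M⟩

theorem geometricRep_simple (i : B) (v : B → ℝ) :
    cs.geometricRep (cs.simple i) v = v - simpleCoroot M i v • Pi.single i 1 := by
  rw [geometricRep, lift_apply_simple]
  exact reflection_apply _ _

theorem geometricRep_wordProd_apply_of_notMem {l : List B} {i : B} (hi : i ∉ l) (v : B → ℝ) :
    cs.geometricRep (cs.wordProd l) v i = v i := by
  induction l with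
  | nil => simp
  | cons j l ih =>
    rw [List.mem_cons, not_or] at hi
    rw [wordProd_cons, map_mul, Module.End.mul_apply, geometricRep_simple]
    simp [ih hi.2, hi.1]

/-- Move the first letter `i` to the other side: the remaining word leaves coordinate `i` alone,
while `s_i` shifts it by the coroot value. That value therefore vanishes, and the remaining word
fixes `v` too. -/
theorem simpleCoroot_eq_zero_of_fixed {l : List B} (hl : l.Nodup) {v : B → ℝ}
    (h : cs.geometricRep (cs.wordProd l) v = v) : ∀ i ∈ l, simpleCoroot M i v = 0 := by
  induction l with
  | nil => simp
  | cons i l ih =>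
    rw [List.nodup_cons] at hl
    have h1 : cs.geometricRep (cs.wordProd l) v = v - simpleCoroot M i v • Pi.single i 1 := by
      rw [← cs.geometricRep_simple]
      nth_rw 2 [← h]
      rw [wordProd_cons, map_mul, Module.End.mul_apply, ← Module.End.mul_apply, ← map_mul,
        simple_mul_simple_self, map_one, Module.End.one_apply]
    have h2 : simpleCoroot M i v = 0 := by
      have := congrFun h1 i
      rw [geometricRep_wordProd_apply_of_notMem cs hl.1, Pi.sub_apply, Pi.smul_apply,
        Pi.single_eq_same, smul_eq_mul, mul_one] at this
      linarith
    rw [h2, zero_smul, sub_zero] at h1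
    intro j hj
    rcases List.mem_cons.1 hj with rfl | hj
    · exact h2
    · exact ih hl.2 h1 j hj

/-- Such a `v` is fixed by `W`. The sum of all group elements kills every simple root, as `s_i`
negates it, hence is zero; on `v` it is multiplication by `|W|`. -/
theorem eq_zero_of_simpleCoroot_eq_zero [Finite W] (cs : CoxeterSystem M W) {v : B → ℝ}
    (h : ∀ i, simpleCoroot M i v = 0) : v = 0 := by
  have := Fintype.ofFinite W
  have hfix : ∀ w, cs.geometricRep w v = v := by
    intro w
    induction w using cs.simple_induction_left with
    | one => simp
    | mul_simple_left w i ih =>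
      rw [map_mul, Module.End.mul_apply, ih, geometricRep_simple, h i, zero_smul, sub_zero]
  funext j
  let F : Dual ℝ (B → ℝ) := ∑ w : W, (LinearMap.proj j).comp (cs.geometricRep w)
  have hF : F = 0 := by
    refine (Pi.basisFun ℝ B).ext fun i => ?_
    have hneg : cs.geometricRep (cs.simple i) (Pi.single i 1) = -Pi.single i 1 := by
      rw [geometricRep_simple, simpleCoroot_single_self]
      module
    have h1 : F (Pi.single i 1) = -F (Pi.single i 1) := by
      simp only [F, LinearMap.sum_apply, LinearMap.comp_apply, ← Finset.sum_neg_distrib]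
      refine Fintype.sum_equiv (Equiv.mulRight (cs.simple i)) _ _ fun w => ?_
      rw [Equiv.coe_mulRight, map_mul, Module.End.mul_apply, hneg, map_neg, map_neg, neg_neg]
    rw [Pi.basisFun_apply, LinearMap.zero_apply]
    linarith
  have h2 : F v = Fintype.card W * v j := by
    simp [F, hfix]
  rw [hF, LinearMap.zero_apply] at h2
  have h3 : (Fintype.card W : ℝ) ≠ 0 := by simp
  simpa [h3] using h2.symm

theorem finrank_moved_simple_le (i : B) :
    finrank ℝ (cs.geometricRep.moved (cs.simple i)) ≤ 1 := by
  have : cs.geometricRep.moved (cs.simple i) ≤ Submodule.span ℝ {Pi.single i 1} := by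
    rintro _ ⟨x, rfl⟩
    refine Submodule.mem_span_singleton.2 ⟨-simpleCoroot M i x, ?_⟩
    rw [LinearMap.sub_apply, geometricRep_simple, Module.End.one_apply]
    module
  exact (Submodule.finrank_mono this).trans (by
    simpa using finrank_span_le_card (R := ℝ) {(Pi.single i 1 : B → ℝ)})

theorem finrank_moved_le_absLength (w : W) :
    finrank ℝ (cs.geometricRep.moved w) ≤ cs.absLength w := by
  obtain ⟨l, hl, rfl, hlen⟩ := cs.exists_absLength w
  rw [← hlen]
  clear hlen
  induction l with
  | nil => rw [List.prod_nil, Representation.moved_one, finrank_bot, List.length_nil]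
  | cons t l ih =>
    rw [List.forall_mem_cons] at hl
    rw [List.prod_cons, List.length_cons, add_comm]
    refine (Representation.finrank_moved_mul_le _ _ _).trans (add_le_add ?_ (ih hl.2))
    obtain ⟨g, i, rfl⟩ := hl.1
    rw [Representation.moved_conj]
    exact (Submodule.finrank_map_le _ _).trans (cs.finrank_moved_simple_le i)

variable {cs} {c : W}

theorem IsCoxeterElement.moved_eq_top [Finite W] (hc : cs.IsCoxeterElement c) :
    cs.geometricRep.moved c = ⊤ := by
  obtain ⟨_, ⟨l, hl, hmem, rfl⟩, hconj⟩ := hc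
  obtain ⟨g, rfl⟩ := isConj_iff.1 hconj
  have h : cs.geometricRep.moved (cs.wordProd l) = ⊤ := by
    refine LinearMap.ker_eq_bot_iff_range_eq_top.1 (LinearMap.ker_eq_bot'.2 fun v hv => ?_)
    rw [LinearMap.sub_apply, Module.End.one_apply, sub_eq_zero] at hv
    exact cs.eq_zero_of_simpleCoroot_eq_zero fun i =>
      cs.simpleCoroot_eq_zero_of_fixed hl hv i (hmem i)
  rw [Representation.moved_conj, h, Submodule.map_top, LinearMap.range_eq_top]
  intro v
  exact ⟨cs.geometricRep g⁻¹ v, by simp⟩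

theorem IsCoxeterElement.absLength_eq [Finite W] (hc : cs.IsCoxeterElement c) :
    cs.absLength c = Fintype.card B := by
  refine le_antisymm hc.absLength_le ?_
  have := cs.finrank_moved_le_absLength c
  rwa [hc.moved_eq_top, finrank_top, finrank_fintype_fun_eq_card] at this

/-- Dimensions of moved spaces are subadditive and bounded by lengths; as lengths add up and `w`
attains its bound, equality holds throughout. The bound thus passes from `c` to everything below it.
-/
theorem AbsLE.moved {v w : W} (h : cs.AbsLE v w)
    (hw : cs.absLength w ≤ finrank ℝ (cs.geometricRep.moved w)) :
    finrank ℝ (cs.geometricRep.moved v) = cs.absLength v ∧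
    finrank ℝ (cs.geometricRep.moved (v⁻¹ * w)) = cs.absLength (v⁻¹ * w) ∧
    cs.geometricRep.moved v ⊔ cs.geometricRep.moved (v⁻¹ * w) = cs.geometricRep.moved w ∧
    cs.geometricRep.moved v ⊓ cs.geometricRep.moved (v⁻¹ * w) = ⊥ := by
  have h1 := cs.finrank_moved_le_absLength v
  have h2 := cs.finrank_moved_le_absLength (v⁻¹ * w)
  have h3 := cs.geometricRep.moved_mul_le v (v⁻¹ * w)
  rw [mul_inv_cancel_left] at h3
  have h4 := Submodule.finrank_mono h3
  have h5 := Submodule.finrank_sup_add_finrank_inf_eq (cs.geometricRep.moved v)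
    (cs.geometricRep.moved (v⁻¹ * w))
  unfold AbsLE at h
  refine ⟨by omega, by omega, (Submodule.eq_of_le_of_finrank_le h3 (by omega)).symm, ?_⟩
  exact Submodule.finrank_eq_zero.1 (by omega)

/-! ### Flags of moved spaces and the inversion count -/

/-- The complete flag of moved spaces of a maximal chain of non-crossing partitions. -/
noncomputable def movedFlag (F : Flag (cs.NC c)) (k : ℕ) : Submodule ℝ (B → ℝ) :=
  cs.geometricRep.moved (flagElt F k).1

theorem movedFlag_zero (F : Flag (cs.NC c)) : movedFlag F 0 = ⊥ := by
  rw [movedFlag, flagElt_zero, Representation.moved_one]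

variable [Finite W]

theorem IsCoxeterElement.absLength_le_finrank_moved (hc : cs.IsCoxeterElement c) :
    cs.absLength c ≤ finrank ℝ (cs.geometricRep.moved c) := by
  rw [hc.moved_eq_top, finrank_top, finrank_fintype_fun_eq_card, hc.absLength_eq]

theorem finrank_movedFlag (hc : cs.IsCoxeterElement c) (F : Flag (cs.NC c)) (k : ℕ) :
    finrank ℝ (movedFlag F k) = min k (Fintype.card B) := by
  rw [movedFlag, ((flagElt F k).2.moved hc.absLength_le_finrank_moved).1, absLength_flagElt,
    hc.absLength_eq]

theorem movedFlag_mono (hc : cs.IsCoxeterElement c) (F : Flag (cs.NC c)) :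
    Monotone (movedFlag F) := by
  intro k m hkm
  have h := AbsLE.moved (cs := cs) (flagElt_mono F hkm)
    (((flagElt F m).2.moved hc.absLength_le_finrank_moved).1.ge)
  exact le_sup_left.trans h.2.2.1.le

theorem movedFlag_card (hc : cs.IsCoxeterElement c) (F : Flag (cs.NC c)) :
    movedFlag F (Fintype.card B) = ⊤ := by
  rw [movedFlag, flagElt_of_le F hc.absLength_eq.le, hc.moved_eq_top]

theorem movedFlag_lt_succ (hc : cs.IsCoxeterElement c) (F : Flag (cs.NC c)) {k : ℕ}
    (hk : k < Fintype.card B) : movedFlag F k < movedFlag F (k + 1) := by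
  refine lt_of_le_of_ne (movedFlag_mono hc F (Nat.le_succ k)) fun h => ?_
  have h1 := finrank_movedFlag hc F k
  have h2 := finrank_movedFlag hc F (k + 1)
  rw [← h, h1] at h2
  omega

theorem movedFlag_succ_le (hc : cs.IsCoxeterElement c) (F : Flag (cs.NC c)) (k : ℕ)
    (x : B → ℝ) (hx : x ∈ movedFlag F (k + 1)) (hx' : x ∉ movedFlag F k) :
    movedFlag F (k + 1) ≤ movedFlag F k ⊔ Submodule.span ℝ {x} := by
  have h1 := finrank_movedFlag hc F k
  have h2 := finrank_movedFlag hc F (k + 1)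
  have h3 : movedFlag F k ⊔ Submodule.span ℝ {x} ≤ movedFlag F (k + 1) :=
    sup_le (movedFlag_mono hc F (Nat.le_succ k)) ((Submodule.span_singleton_le_iff_mem _ _).2 hx)
  have h4 : movedFlag F k < movedFlag F k ⊔ Submodule.span ℝ {x} := by
    refine lt_of_le_of_ne le_sup_left fun h => hx' ?_
    rw [h]
    exact Submodule.mem_sup_right (Submodule.mem_span_singleton_self x)
  have h5 := Submodule.finrank_lt_finrank_of_lt h4
  exact (Submodule.eq_of_le_of_finrank_le h3 (by omega)).ge

theorem movedFlag_inf_oppositeFlag (hc : cs.IsCoxeterElement c) (F : Flag (cs.NC c)) {k : ℕ}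
    (hk : k ≤ Fintype.card B) :
    movedFlag F k ⊓ movedFlag (oppositeFlag F) (Fintype.card B - k) = ⊥ := by
  rw [movedFlag, movedFlag, ← hc.absLength_eq, flagElt_oppositeFlag F (hc.absLength_eq ▸ hk)]
  exact ((flagElt F k).2.moved hc.absLength_le_finrank_moved).2.2.2

/-- The number of inversions of the relative position of two maximal chains. -/
noncomputable def relInversions (C F : Flag (cs.NC c)) : ℕ :=
  (inversionPairs (Fintype.card B) (relPos (movedFlag C) (movedFlag F))).card

theorem relInversions_self (hc : cs.IsCoxeterElement c) (C : Flag (cs.NC c)) :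
    relInversions C C = 0 := by
  rw [relInversions, Finset.card_eq_zero]
  have h : ∀ i < Fintype.card B, relPos (movedFlag C) (movedFlag C) i = i + 1 := fun i hi =>
    relPos_eq (movedFlag_mono hc C) (by simpa using (movedFlag_lt_succ hc C hi).not_ge)
      inf_le_left
  refine inversionPairs_eq_empty fun j hj i hi => ?_
  rw [h j hj, h i (hi.trans hj)]
  omega

theorem relInversions_oppositeFlag (hc : cs.IsCoxeterElement c) (C : Flag (cs.NC c)) :
    relInversions C (oppositeFlag C) = (Fintype.card B).choose 2 := by
  have h : ∀ i < Fintype.card B,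
      relPos (movedFlag C) (movedFlag (oppositeFlag C)) i = Fintype.card B - (i + 1) + 1 := by
    intro i hi
    refine relPos_eq (movedFlag_mono hc _) (fun hle => ?_) ?_
    -- The spaces of dimensions `n - i` and `i + 1` must meet, and the former meets `C i` only in
    -- zero.
    · have h1 := movedFlag_inf_oppositeFlag hc C hi.le
      rw [show Fintype.card B - i = Fintype.card B - (i + 1) + 1 by omega] at h1
      have h2 : movedFlag (oppositeFlag C) (Fintype.card B - (i + 1) + 1) ⊓ movedFlag C (i + 1)
          = ⊥ := le_bot_iff.1 (h1 ▸ le_inf hle inf_le_left)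
      have h3 := Submodule.finrank_add_finrank_le_of_disjoint (disjoint_iff.2 h2)
      rw [finrank_movedFlag hc, finrank_movedFlag hc, finrank_fintype_fun_eq_card] at h3
      omega
    · rw [inf_comm, movedFlag_inf_oppositeFlag hc C hi]
      exact bot_le
  refine card_inversionPairs_of_anti fun j hj i hi => ?_
  rw [h j hj, h i (hi.trans hj)]
  omega

theorem relInversions_le_of_adj (hc : cs.IsCoxeterElement c) (C : Flag (cs.NC c))
    {F F' : Flag (cs.NC c)} (h : (cs.hurwitzGraph c).Adj F F') :
    relInversions C F' ≤ relInversions C F + 1 := by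
  obtain ⟨j, hj⟩ := exists_flagElt_eq_of_adj h
  have hcongr := fun i (hi : i < Fintype.card B) =>
    relPos_congr (movedFlag_mono hc F) (movedFlag_mono hc F') (movedFlag_card hc F)
      (fun k hk => by rw [movedFlag, movedFlag, hj k hk]) (movedFlag_lt_succ hc C hi)
  refine card_inversionPairs_le_add_one (j := j) (fun a ha b hb => ?_)
    (fun a ha => (hcongr a ha).1) (fun a ha => (hcongr a ha).2)
  exact relPos_injOn (movedFlag_zero F) (movedFlag_card hc F) (movedFlag_mono hc C)
    (movedFlag_succ_le hc F) (movedFlag_lt_succ hc C ha) (movedFlag_lt_succ hc C hb)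

theorem relInversions_le_of_walk (hc : cs.IsCoxeterElement c) (C : Flag (cs.NC c))
    {F F' : Flag (cs.NC c)} (p : (cs.hurwitzGraph c).Walk F F') :
    relInversions C F' ≤ relInversions C F + p.length := by
  induction p with
  | nil => simp
  | cons h p ih =>
    have := relInversions_le_of_adj hc C h
    rw [SimpleGraph.Walk.length_cons]
    omega

end Geometric

end CoxeterSystem

theorem mainTheorem6 {B W : Type*} [Fintype B] [Group W] [Finite W] {M : CoxeterMatrix B}
    (cs : CoxeterSystem M W) (c : W) (hc : cs.IsCoxeterElement c) :
    (((Fintype.card B).choose 2 : ℕ) : ℕ∞) ≤ (cs.hurwitzGraph c).radius := by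
  classical
  refine le_iInf fun C => le_trans ?_
    (SimpleGraph.edist_le_eccent (v := CoxeterSystem.oppositeFlag C))
  -- `edist` is an infimum over walks, infinite if there are none, so connectedness plays no role.
  refine le_iInf fun p => ?_
  have := CoxeterSystem.relInversions_le_of_walk hc C p
  rw [CoxeterSystem.relInversions_self hc, CoxeterSystem.relInversions_oppositeFlag hc,
    zero_add] at this
  exact_mod_cast this
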